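/- Let $G$ be a finite abelian group, written additively. A subset $C \subseteq G$ is called a minimal complement in $G$ if there is a subset $W \subseteq G$ such that $W + C = G$ and $W + C' \neq G$ for every proper subset $C' \subsetneq C$. Let $T(G)$ be the greatest integer $T \le |G|$ such that every non-empty subset $C \subseteq G$ with $|C| \le T$ is a minimal complement in $G$, and for an integer $n \ge 1$ let $T(n)$ be the minimum of $T(G)$ over all abelian groups $G$ of order $n$. Theorem. For every $\varepsilon > 0$ there is a constant $K = K(\varepsilon)$ such that $T(G) \le K\,|G|^{3/4+\varepsilon}$ for every finite abelian group $G$. In particular, for every $\varepsilon > 0$ we have $T(n) = O(n^{3/4+\varepsilon})$, that is, there is a constant $K' = K'(\varepsilon)$ with $T(n) \le K'\, n^{3/4+\varepsilon}$ for all $n \ge 1$. Moreover, for $0 < \varepsilon < 1/4$, a random subset $A$ of $G$, formed by including each element of $G$ independently with probability $p = |G|^{\varepsilon - 1/4}$, is with high probability not a minimal complement: for every $\delta > 0$ there is an $N = N(\varepsilon, \delta)$ such that for every finite abelian group $G$ with $|G| \ge N$, the set $A$ is not a minimal complement in $G$ with probability at least $1 - \delta$. -/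

import Mathlib

open scoped Pointwise

universe u

/-- `C` is an additive complement for `W` in `G`: `W + C = G`. -/
def IsAddComplement {G : Type u} [AddCommGroup G] (W C : Set G) : Prop :=
  W + C = Set.univ

/-- `C` is a minimal additive complement for `W`: it is a complement for `W`, and no proper subset
of `C` is. -/
def IsMinimalComplementFor {G : Type u} [AddCommGroup G] (W C : Set G) : Prop :=
  IsAddComplement W C ∧ ∀ D : Set G, D ⊂ C → ¬ IsAddComplement W D

/-- `C` is a minimal complement in `G`: it is a minimal complement for some `W ⊆ G`. -/
def IsMinimalComplement {G : Type u} [AddCommGroup G] (C : Set G) : Prop :=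
  ∃ W : Set G, IsMinimalComplementFor W C

/-- `T(G)`, for a finite abelian group `G`: the greatest integer `T ≤ |G|` such that every
non-empty subset of `G` of size at most `T` is a minimal complement in `G`. The set below
contains `0` and is bounded above by `|G|`, so the supremum is a maximum. (The empty set is never a
complement and has to be excluded; the bound `T ≤ |G|` only matters if all non-empty subsets of `G`
are minimal complements, and then `T(G) = |G|`.) -/
noncomputable def minimalComplementThreshold (G : Type u) [AddCommGroup G] : ℕ :=
  sSup {T : ℕ | T ≤ Nat.card G ∧
    ∀ C : Set G, C.Nonempty → C.ncard ≤ T → IsMinimalComplement C}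

/-- `T(n)`, for `n ≥ 1`: the minimum of `T(G)` over all abelian groups `G` of order `n`. (Every
finite group is isomorphic to one in `Type`.) -/
noncomputable def minimalComplementThresholdOfOrder (n : ℕ) : ℕ :=
  sInf {t : ℕ | ∃ (G : Type) (_ : AddCommGroup G), Finite G ∧ Nat.card G = n ∧
    minimalComplementThreshold G = t}

/-! Let `n = |G|`, `L = log n`, `p = n ^ (ε - 1/4)`, and let `A` be a random set of density `p`.
Suppose `A` is a minimal complement for some `V`. The set `V` is unknown and may have any size, but
it can be replaced by a set `W` of one fixed size `k ≈ L / (4p)` (`exists_of_isMinimalComplement`).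
If `V` is small, enlarge it: `A` still meets every `g - W`. If `V` is large, shrink it: each `a ∈ A`
is the only element of `A` in some `g - V`, so at least `|A|` of the sets `g - W` contain at most
one point of `A`.

For fixed `W` both events are very unlikely. A given `g - W` misses `A` with probability about `n ^
(-1/4)`, and contains at most one point of `A` with probability about `L * n ^ (-1/4)`, which is
much less than `p`. Translates whose indices differ by an element outside `W - W` are disjoint,
hence independent, and about `n / k ^ 2` of them can be chosen. The covering event is bounded by a
product over such a family, the other by a moment of the number of sparse translates, counted
through separated tuples.

The resulting bounds beat the `n ^ k` choices of `W` once `p` exceeds `n ^ (-1/4)` by a power of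
`L`. As `|A|` is concentrated near `p * n = n ^ (3/4 + ε)`, some set of that size is not a minimal
complement. -/

open Finset

/-! ### Bernoulli random subsets -/

section Weight

variable {G : Type u} [Fintype G] [DecidableEq G]

/-- The probability that a random subset of `G`, containing each element independently with
probability `p`, is equal to `A`. -/
def bernoulliWeight (p : ℝ) (A : Finset G) : ℝ := p ^ #A * (1 - p) ^ #Aᶜ

lemma bernoulliWeight_nonneg {p : ℝ} (h0 : 0 ≤ p) (h1 : p ≤ 1) (A : Finset G) :
    0 ≤ bernoulliWeight p A :=
  mul_nonneg (pow_nonneg h0 _) (pow_nonneg (sub_nonneg.2 h1) _)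

/-- The generating function of the binomial variable `#(A ∩ S)`. -/
lemma sum_bernoulliWeight_mul_pow (p t : ℝ) (S : Finset G) :
    ∑ A : Finset G, bernoulliWeight p A * t ^ #(A ∩ S) = (1 - p + p * t) ^ #S := by
  have h := Fintype.prod_add (fun a : G ↦ p * if a ∈ S then t else 1) (fun _ ↦ 1 - p)
  have h2 : ∏ a : G, ((p * if a ∈ S then t else 1) + (1 - p)) = (1 - p + p * t) ^ #S := by
    rw [← Finset.prod_subset (Finset.subset_univ S) (by intro x _ hx; simp [hx]),
      Finset.prod_congr rfl (g := fun _ ↦ 1 - p + p * t) (by intro x hx; simp [hx]; ring)]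
    simp
  rw [← h2, h]
  refine Finset.sum_congr rfl fun A _ ↦ ?_
  rw [Finset.prod_mul_distrib, Finset.prod_const, Finset.prod_const, Finset.prod_ite_mem,
    Finset.prod_const, bernoulliWeight]
  ring

lemma sum_bernoulliWeight (p : ℝ) : ∑ A : Finset G, bernoulliWeight p A = 1 := by
  simpa using sum_bernoulliWeight_mul_pow (G := G) p 1 ∅

/-- Markov's inequality. -/
lemma sum_filter_bernoulliWeight_le {p : ℝ} (h0 : 0 ≤ p) (h1 : p ≤ 1) (E : Finset G → Prop)
    [DecidablePred E] (f : Finset G → ℝ) (hf : ∀ A, 0 ≤ f A) (hE : ∀ A, E A → 1 ≤ f A) :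
    ∑ A with E A, bernoulliWeight p A ≤ ∑ A, bernoulliWeight p A * f A := by
  rw [Finset.sum_filter]
  refine Finset.sum_le_sum fun A _ ↦ ?_
  have hw := bernoulliWeight_nonneg h0 h1 A
  split_ifs with h
  · exact le_mul_of_one_le_right hw (hE A h)
  · exact mul_nonneg hw (hf A)

lemma setBernoulli_real_eq_sum (p : unitInterval) (E : Set (Set G))
    [DecidablePred fun A : Finset G ↦ (A : Set G) ∈ E] :
    (ProbabilityTheory.setBernoulli (Set.univ : Set G) p).real E =
      ∑ A ∈ (univ : Finset (Finset G)).filter (fun A : Finset G ↦ (A : Set G) ∈ E),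
        bernoulliWeight (p : ℝ) A := by
  have hE : E = ⋃ A ∈ (univ : Finset (Finset G)).filter (fun A : Finset G ↦ (A : Set G) ∈ E), {(A : Set G)} := by
    ext s
    simp only [Finset.mem_filter, Finset.mem_univ, true_and, Set.mem_iUnion, Set.mem_singleton_iff,
      exists_prop]
    refine ⟨fun h ↦ ⟨s.toFinite.toFinset, by simpa using h, by simp⟩, ?_⟩
    rintro ⟨A, hA, rfl⟩
    exact hA
  conv_lhs => rw [hE]
  rw [MeasureTheory.measureReal_biUnion_finset]
  · refine Finset.sum_congr rfl fun A _ ↦ ?_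
    rw [ProbabilityTheory.setBernoulli_real_singleton p (Set.subset_univ _) Set.finite_univ,
      ← Finset.coe_univ, ← Finset.coe_sdiff, Set.ncard_coe_finset, Set.ncard_coe_finset,
      bernoulliWeight, Finset.compl_eq_univ_sdiff]
  · intro A _ B _ hAB
    simpa [Function.onFun] using hAB
  · intro A _
    exact measurableSet_singleton _

/-- The probability that the random set meets each of `m` disjoint sets of size `k`. -/
lemma sum_bernoulliWeight_meets {m k : ℕ} (p : ℝ) (B : Fin m → Finset G)
    (hB : ∀ i, #(B i) = k) (hd : Pairwise fun i j ↦ Disjoint (B i) (B j)) :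
    ∑ A with ∀ i, (A ∩ B i).Nonempty, bernoulliWeight p A = (1 - (1 - p) ^ k) ^ m := by
  -- `0 ^ j` is the indicator of `j = 0`, so inclusion-exclusion reduces the claim to the generating
  -- function at `t = 0`.
  have key (A : Finset G) : (if ∀ i, (A ∩ B i).Nonempty then bernoulliWeight p A else 0) =
      bernoulliWeight p A * ∏ i, (1 - (0 : ℝ) ^ #(A ∩ B i)) := by
    split_ifs with h
    · rw [Finset.prod_eq_one, mul_one]
      intro i _
      rw [zero_pow (Finset.card_pos.2 (h i)).ne', sub_zero]
    · push Not at h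
      obtain ⟨i, hi⟩ := h
      rw [Finset.prod_eq_zero (Finset.mem_univ i) (by simp [hi]), mul_zero]
  have expand (f : Fin m → ℝ) : ∏ i, (1 - f i) = ∑ t : Finset (Fin m), (-1) ^ #t * ∏ i ∈ t, f i := by
    have h := Fintype.prod_add (fun i ↦ -f i) (fun _ ↦ (1 : ℝ))
    simp only [neg_add_eq_sub] at h
    rw [h]
    refine Finset.sum_congr rfl fun t _ ↦ ?_
    rw [Finset.prod_neg, Finset.prod_const_one, mul_one]
  have hunion (t : Finset (Fin m)) (A : Finset G) :
      #(A ∩ t.biUnion B) = ∑ i ∈ t, #(A ∩ B i) := by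
    rw [Finset.inter_biUnion, Finset.card_biUnion]
    intro i _ j _ hij
    exact (hd hij).mono Finset.inter_subset_right Finset.inter_subset_right
  rw [Finset.sum_filter, Finset.sum_congr rfl fun A _ ↦ key A]
  simp_rw [expand, Finset.mul_sum]
  rw [Finset.sum_comm]
  have : (1 - (1 - p) ^ k) ^ m = ∏ _i : Fin m, (1 - (1 - p) ^ k) := by simp
  rw [this, expand]
  refine Finset.sum_congr rfl fun t _ ↦ ?_
  have h := sum_bernoulliWeight_mul_pow p 0 (t.biUnion B)
  rw [mul_zero, add_zero, Finset.card_biUnion (fun i _ j _ hij ↦ hd hij),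
    Finset.sum_congr rfl fun i _ ↦ hB i] at h
  rw [Finset.prod_const, ← pow_mul, mul_comm k]
  rw [Finset.sum_const, smul_eq_mul] at h
  rw [← h, Finset.mul_sum]
  refine Finset.sum_congr rfl fun A _ ↦ ?_
  rw [Finset.prod_pow_eq_pow_sum, hunion]
  ring

/-- An upper bound for the probability that the random set has at most one element in common with
each of `m` disjoint sets of size `k`. -/
lemma sum_bernoulliWeight_card_inter_le_one {m k : ℕ} {p x : ℝ} (h0 : 0 ≤ p) (h1 : p ≤ 1)
    (hx0 : 0 < x) (hx1 : x ≤ 1) (B : Fin m → Finset G)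
    (hB : ∀ i, #(B i) = k) (hd : Pairwise fun i j ↦ Disjoint (B i) (B j)) :
    ∑ A with ∀ i, #(A ∩ B i) ≤ 1, bernoulliWeight p A ≤ (x⁻¹ * (1 - p + p * x) ^ k) ^ m := by
  have hunion (A : Finset G) : #(A ∩ univ.biUnion B) = ∑ i, #(A ∩ B i) := by
    rw [Finset.inter_biUnion, Finset.card_biUnion]
    intro i _ j _ hij
    exact (hd hij).mono Finset.inter_subset_right Finset.inter_subset_right
  -- Exponential Markov: on the event the union of the blocks contains at most `m` points of `A`,
  -- and `x ≤ 1`.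
  refine (sum_filter_bernoulliWeight_le h0 h1 _
    (fun A ↦ x⁻¹ ^ m * x ^ #(A ∩ univ.biUnion B)) (fun A ↦ by positivity) ?_).trans_eq ?_
  · intro A hA
    have : #(A ∩ univ.biUnion B) ≤ m := by
      rw [hunion]
      exact (Finset.sum_le_sum fun i _ ↦ hA i).trans (by simp)
    calc (1 : ℝ) = x⁻¹ ^ m * x ^ m := by rw [← mul_pow, inv_mul_cancel₀ hx0.ne', one_pow]
      _ ≤ _ := by gcongr ?_ * ?_; exact pow_le_pow_of_le_one hx0.le hx1 this
  · simp_rw [mul_left_comm _ (x⁻¹ ^ m), ← Finset.mul_sum]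
    rw [sum_bernoulliWeight_mul_pow, Finset.card_biUnion (fun i _ j _ hij ↦ hd hij),
      Finset.sum_congr rfl fun i _ ↦ hB i]
    simp [mul_pow, ← pow_mul, mul_comm]

end Weight

/-! ### Reflected translates and their disjointness -/

section ReflectedTranslate

variable {G : Type u} [AddCommGroup G] [DecidableEq G]

/-- The set `g - W`. -/
def reflectedTranslate (W : Finset G) (g : G) : Finset G := W.image (g - ·)

lemma mem_reflectedTranslate {W : Finset G} {g a : G} :
    a ∈ reflectedTranslate W g ↔ ∃ w ∈ W, w + a = g := by
  simp only [reflectedTranslate, Finset.mem_image]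
  refine exists_congr fun w ↦ and_congr_right fun _ ↦ ?_
  rw [sub_eq_iff_eq_add, add_comm, eq_comm]

lemma card_reflectedTranslate (W : Finset G) (g : G) : #(reflectedTranslate W g) = #W :=
  Finset.card_image_of_injective _ fun _ _ h ↦ sub_right_injective h

lemma reflectedTranslate_mono {V W : Finset G} (h : V ⊆ W) (g : G) :
    reflectedTranslate V g ⊆ reflectedTranslate W g :=
  Finset.image_subset_image h

lemma disjoint_reflectedTranslate {W : Finset G} {g h : G} (hgh : g - h ∉ W - W) :
    Disjoint (reflectedTranslate W g) (reflectedTranslate W h) := by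
  rw [Finset.disjoint_left]
  intro a ha hb
  obtain ⟨w, hw, rfl⟩ := mem_reflectedTranslate.1 ha
  obtain ⟨v, hv, rfl⟩ := mem_reflectedTranslate.1 hb
  refine hgh ?_
  rw [add_sub_add_right_eq_sub]
  exact Finset.sub_mem_sub hw hv

lemma neg_mem_sub_self {W : Finset G} : ∀ x ∈ W - W, -x ∈ W - W := by
  intro x hx
  obtain ⟨a, ha, b, hb, rfl⟩ := Finset.mem_sub.1 hx
  rw [neg_sub]
  exact Finset.sub_mem_sub hb ha

end ReflectedTranslate

/-! ### Separated tuples and the dichotomy for minimal complements -/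

section Tuples

variable {G : Type u} [AddCommGroup G] [Fintype G] [DecidableEq G]

/-- The `m`-tuples in `S` whose pairwise differences avoid `D`. -/
def separatedTuples (D S : Finset G) (m : ℕ) : Finset (Fin m → G) :=
  {f | (∀ i, f i ∈ S) ∧ ∀ i j, i ≠ j → f i - f j ∉ D}

/-- Greedy choice: each point already chosen forbids at most `#D` further ones, symmetry of `D`
making one order of subtraction enough. Fixing `M` keeps the base constant in the induction. -/
lemma pow_le_card_separatedTuples {D : Finset G} (hD : ∀ x ∈ D, -x ∈ D) (S : Finset G)
    {m M : ℕ} (hm : m ≤ M) : (#S - M * #D) ^ m ≤ #(separatedTuples D S m) := by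
  induction m with
  | zero =>
    simp [separatedTuples]
  | succ m ih =>
    let N (f : Fin m → G) : Finset G := S \ univ.biUnion fun i ↦ D.image (· + f i)
    have hN (f : Fin m → G) : #S - M * #D ≤ #(N f) := by
      refine le_trans ?_ (Finset.le_card_sdiff _ _)
      refine Nat.sub_le_sub_left ?_ _
      calc #(univ.biUnion fun i ↦ D.image (· + f i)) ≤ ∑ i : Fin m, #(D.image (· + f i)) :=
            Finset.card_biUnion_le
        _ ≤ ∑ _i : Fin m, #D := Finset.sum_le_sum fun i _ ↦ Finset.card_image_le
        _ = m * #D := by simp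
        _ ≤ M * #D := Nat.mul_le_mul_right _ (by omega)
    calc (#S - M * #D) ^ (m + 1) = (#S - M * #D) ^ m * (#S - M * #D) := pow_succ _ _
      _ ≤ #(separatedTuples D S m) * (#S - M * #D) := Nat.mul_le_mul_right _ (ih (by omega))
      _ = ∑ f ∈ separatedTuples D S m, (#S - M * #D) := by simp
      _ ≤ ∑ f ∈ separatedTuples D S m, #(N f) := Finset.sum_le_sum fun f _ ↦ hN f
      _ = #((separatedTuples D S m).sigma N) := (Finset.card_sigma _ _).symm
      _ ≤ #(separatedTuples D S (m + 1)) := by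
        refine Finset.card_le_card_of_injOn
          (fun x ↦ (Fin.cons x.2 x.1 : Fin (m + 1) → G)) ?_ ?_
        · rintro ⟨f, g⟩ hx
          simp only [separatedTuples, Finset.coe_sigma, Set.mem_sigma_iff, Finset.mem_coe,
            Finset.mem_filter, Finset.mem_univ, true_and, N, Finset.mem_sdiff, Finset.mem_biUnion,
            Finset.mem_image, not_exists, not_and] at hx ⊢
          obtain ⟨⟨hf, hfd⟩, hg, hgd⟩ := hx
          have hgD (i : Fin m) : g - f i ∉ D := fun h ↦ hgd i _ h (sub_add_cancel _ _)
          refine ⟨fun i ↦ ?_, fun i j hij ↦ ?_⟩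
          · cases i using Fin.cases with
            | zero => exact hg
            | succ i => exact hf i
          · cases i using Fin.cases with
            | zero =>
              cases j using Fin.cases with
              | zero => exact absurd rfl hij
              | succ j => exact hgD j
            | succ i =>
              cases j using Fin.cases with
              | zero =>
                intro h
                refine hgD i ?_
                have := hD _ h
                rwa [neg_sub] at this
              | succ j => exact hfd i j fun h ↦ hij (by rw [h])
        · rintro ⟨f, g⟩ _ ⟨f', g'⟩ _ h
          obtain ⟨h1, h2⟩ := Fin.cons_injective2 h
          subst h1 h2
          rfl

lemma pairwise_disjoint_of_mem_separatedTuples {W S : Finset G} {m : ℕ} {f : Fin m → G}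
    (hf : f ∈ separatedTuples (W - W) S m) :
    Pairwise fun i j ↦ Disjoint (reflectedTranslate W (f i)) (reflectedTranslate W (f j)) := by
  intro i j hij
  simp only [separatedTuples, Finset.mem_filter, Finset.mem_univ, true_and] at hf
  exact disjoint_reflectedTranslate (hf.2 i j hij)

/-- The elements of `G` with at most one representation as `w + a` with `w ∈ W` and `a ∈ A`. -/
def sparselyCovered (W A : Finset G) : Finset G := {g | #(A ∩ reflectedTranslate W g) ≤ 1}

/-- This confines the union bound to sets `W` of a single size. Enlarging a small set preserves
covering; shrinking a large one preserves the bound of one representation at the private element of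
each `a ∈ A`. -/
lemma exists_of_isMinimalComplement {A : Finset G} (hA : IsMinimalComplement (A : Set G)) {k : ℕ}
    (hk : k ≤ Fintype.card G) :
    ∃ W : Finset G, #W = k ∧
      ((∀ g, (A ∩ reflectedTranslate W g).Nonempty) ∨ #A ≤ #(sparselyCovered W A)) := by
  obtain ⟨W₀, hW, hmin⟩ := hA
  obtain ⟨V, rfl⟩ : ∃ V : Finset G, (V : Set G) = W₀ := ⟨W₀.toFinite.toFinset, by simp⟩
  have hcompl (D : Finset G) : IsAddComplement (V : Set G) (D : Set G) ↔
      ∀ g, (D ∩ reflectedTranslate V g).Nonempty := by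
    rw [IsAddComplement, Set.eq_univ_iff_forall]
    refine forall_congr' fun g ↦ ?_
    simp only [Set.mem_add, Finset.mem_coe, Finset.Nonempty, Finset.mem_inter,
      mem_reflectedTranslate]
    tauto
  rcases le_total (#V) k with h | h
  · obtain ⟨W, hVW, -, hW'⟩ := Finset.exists_subsuperset_card_eq (Finset.subset_univ V) h
      (by simpa using hk)
    refine ⟨W, hW', Or.inl fun g ↦ ?_⟩
    exact ((hcompl A).1 hW g).mono
      (Finset.inter_subset_inter_left (reflectedTranslate_mono hVW g))
  · obtain ⟨W, hWV, hW'⟩ := Finset.exists_subset_card_eq h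
    refine ⟨W, hW', Or.inr ?_⟩
    -- By minimality, removing `a` uncovers some `g`, so `a` alone represents it. The map from `a`
    -- to `g` is injective because `g` determines `{a}`.
    have hex (a : G) (ha : a ∈ A) : ∃ g, A ∩ reflectedTranslate V g = {a} := by
      have h1 := hmin (A.erase a : Finset G) (by
        rw [Finset.coe_ssubset]; exact Finset.erase_ssubset ha)
      rw [hcompl] at h1
      push Not at h1
      obtain ⟨g, hg⟩ := h1
      refine ⟨g, ?_⟩
      have h2 := (hcompl A).1 hW g
      refine (Finset.Nonempty.subset_singleton_iff h2).1 fun b hb ↦ ?_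
      rw [Finset.mem_inter] at hb
      by_contra hne
      rw [Finset.mem_singleton] at hne
      have : b ∈ A.erase a ∩ reflectedTranslate V g := by simp [hb, hne]
      rw [hg] at this
      simp at this
    choose! γ hγ using hex
    refine Finset.card_le_card_of_injOn γ ?_ ?_
    · intro a ha
      have h1 : #(A ∩ reflectedTranslate W (γ a)) ≤ #(A ∩ reflectedTranslate V (γ a)) :=
        Finset.card_le_card (Finset.inter_subset_inter_left (reflectedTranslate_mono hWV _))
      rw [hγ a ha, Finset.card_singleton] at h1
      simpa [sparselyCovered] using h1
    · intro a ha b hb hab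
      have h1 := hγ a ha
      rw [hab, hγ b hb] at h1
      exact (Finset.singleton_injective h1).symm

end Tuples

/-! ### Probability bounds for fixed `W`, and the union bound -/

section UnionBound

variable {G : Type u} [AddCommGroup G] [Fintype G] [DecidableEq G]

lemma sum_bernoulliWeight_covering_le {p : ℝ} (h0 : 0 ≤ p) (h1 : p ≤ 1) (W : Finset G) {m : ℕ}
    (hm : m * #W ^ 2 < Fintype.card G) :
    ∑ A with ∀ g, (A ∩ reflectedTranslate W g).Nonempty, bernoulliWeight p A ≤
      (1 - (1 - p) ^ #W) ^ m := by
  have hD : #(W - W) ≤ #W ^ 2 := by rw [sq]; exact Finset.card_sub_le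
  have h := pow_le_card_separatedTuples (neg_mem_sub_self (W := W)) univ (le_refl m)
  have hpos : 0 < #(separatedTuples (W - W) univ m) := by
    refine lt_of_lt_of_le (pow_pos (Nat.sub_pos_of_lt ?_) _) h
    exact (Nat.mul_le_mul_left m hD).trans_lt hm
  obtain ⟨f, hf⟩ := Finset.card_pos.1 hpos
  rw [← sum_bernoulliWeight_meets p (fun i ↦ reflectedTranslate W (f i))
    (fun i ↦ card_reflectedTranslate W _) (pairwise_disjoint_of_mem_separatedTuples hf)]
  refine Finset.sum_le_sum_of_subset_of_nonneg ?_ fun A _ _ ↦ bernoulliWeight_nonneg h0 h1 A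
  intro A hA
  simp only [Finset.mem_filter, Finset.mem_univ, true_and] at hA ⊢
  exact fun i ↦ hA _

/-- A moment argument: if `sparselyCovered W A` is large, it contains at least `(a - m * #W ^ 2) ^
m` separated tuples. Their expected number is small, since for each fixed tuple the translates are
disjoint. -/
lemma sum_bernoulliWeight_sparselyCovered_le {p x : ℝ} (h0 : 0 ≤ p) (h1 : p ≤ 1) (hx0 : 0 < x)
    (hx1 : x ≤ 1) (W : Finset G) {a m : ℕ} (hm : m * #W ^ 2 < a) :
    ∑ A with a ≤ #(sparselyCovered W A), bernoulliWeight p A ≤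
      (Fintype.card G * (x⁻¹ * (1 - p + p * x) ^ #W) / (a - m * #W ^ 2)) ^ m := by
  have hD : #(W - W) ≤ #W ^ 2 := by rw [sq]; exact Finset.card_sub_le
  have ha : (0 : ℝ) < a - m * #W ^ 2 := by rw [sub_pos]; exact_mod_cast hm
  refine (sum_filter_bernoulliWeight_le h0 h1 _
    (fun A ↦ (#(separatedTuples (W - W) (sparselyCovered W A) m) : ℝ) / (a - m * #W ^ 2) ^ m)
    (fun A ↦ by positivity) ?_).trans ?_
  · intro A hA
    rw [one_le_div (by positivity)]
    have h := pow_le_card_separatedTuples (neg_mem_sub_self (W := W)) (sparselyCovered W A)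
      (le_refl m)
    have h2 : a - m * #W ^ 2 ≤ #(sparselyCovered W A) - m * #(W - W) :=
      tsub_le_tsub hA (Nat.mul_le_mul_left m hD)
    have h3 := (Nat.pow_le_pow_left h2 m).trans h
    have h4 : ((a - m * #W ^ 2 : ℕ) : ℝ) = a - m * #W ^ 2 := by
      rw [Nat.cast_sub hm.le]; push_cast; ring
    rw [← h4]
    exact_mod_cast h3
  · simp_rw [mul_div_assoc', ← Finset.sum_div]
    rw [mul_div_right_comm, mul_pow, div_pow, div_mul_eq_mul_div]
    gcongr
    have hcard (A : Finset G) : (#(separatedTuples (W - W) (sparselyCovered W A) m) : ℝ) =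
        ∑ f ∈ separatedTuples (W - W) univ m,
          if ∀ i, #(A ∩ reflectedTranslate W (f i)) ≤ 1 then 1 else 0 := by
      rw [Finset.sum_boole]
      congr 2
      ext f
      simp [separatedTuples, sparselyCovered, and_comm]
    simp_rw [hcard, Finset.mul_sum]
    rw [Finset.sum_comm]
    have hf (f) (hf : f ∈ separatedTuples (W - W) univ m) :
        ∑ A : Finset G, (bernoulliWeight p A *
          if ∀ i, #(A ∩ reflectedTranslate W (f i)) ≤ 1 then 1 else 0) ≤
        (x⁻¹ * (1 - p + p * x) ^ #W) ^ m := by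
      simp_rw [mul_ite, mul_one, mul_zero]
      rw [← Finset.sum_filter]
      exact sum_bernoulliWeight_card_inter_le_one h0 h1 hx0 hx1 _
        (fun i ↦ card_reflectedTranslate W _) (pairwise_disjoint_of_mem_separatedTuples hf)
    refine (Finset.sum_le_sum hf).trans ?_
    rw [Finset.sum_const, nsmul_eq_mul]
    have hq : 0 ≤ 1 - p + p * x := by nlinarith
    gcongr
    have : #(separatedTuples (W - W) univ m) ≤ Fintype.card G ^ m := by
      refine (Finset.card_le_univ _).trans ?_
      simp
    exact_mod_cast this

open scoped Classical in
lemma sum_bernoulliWeight_isMinimalComplement_le {p x : ℝ} (h0 : 0 ≤ p) (h1 : p ≤ 1)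
    (hx0 : 0 < x) (hx1 : x ≤ 1) {a k m m' : ℕ} (hk : k ≤ Fintype.card G)
    (hm : m * k ^ 2 < a) (hm' : m' * k ^ 2 < Fintype.card G) :
    ∑ A ∈ univ.filter (fun A : Finset G ↦ IsMinimalComplement (A : Set G) ∧ a ≤ #A),
        bernoulliWeight p A ≤
      (Fintype.card G : ℝ) ^ k * ((1 - (1 - p) ^ k) ^ m' +
        (Fintype.card G * (x⁻¹ * (1 - p + p * x) ^ k) / (a - m * k ^ 2)) ^ m) := by
  -- The sum of `F W A` over all `k`-sets `W` is at least `1` on the event, by the dichotomy.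
  let F (W A : Finset G) : ℝ := (if ∀ g, (A ∩ reflectedTranslate W g).Nonempty then 1 else 0) +
    if a ≤ #(sparselyCovered W A) then 1 else 0
  have hF (W A) : 0 ≤ F W A := by positivity
  refine (sum_filter_bernoulliWeight_le h0 h1 _
    (fun A ↦ ∑ W ∈ powersetCard k univ, F W A) (fun A ↦ Finset.sum_nonneg fun W _ ↦ hF W A)
    ?_).trans ?_
  · rintro A ⟨hA, haA⟩
    obtain ⟨W, hW, h⟩ := exists_of_isMinimalComplement hA hk
    have h1 : 1 ≤ F W A := by
      rcases h with h | h
      · simp only [F, if_pos h]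
        exact le_add_of_nonneg_right (by positivity)
      · simp only [F, if_pos (haA.trans h)]
        exact le_add_of_nonneg_left (by positivity)
    exact h1.trans (Finset.single_le_sum (f := fun W ↦ F W A) (fun W _ ↦ hF W A)
      (by simpa using hW))
  · simp_rw [Finset.mul_sum]
    rw [Finset.sum_comm]
    have hW (W) (hW : W ∈ powersetCard k (univ : Finset G)) :
        ∑ A, bernoulliWeight p A * F W A ≤ (1 - (1 - p) ^ k) ^ m' +
        (Fintype.card G * (x⁻¹ * (1 - p + p * x) ^ k) / (a - m * k ^ 2)) ^ m := by
      have hc : #W = k := by simpa using hW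
      subst hc
      simp only [F, mul_add, mul_ite, mul_one, mul_zero, Finset.sum_add_distrib]
      rw [← Finset.sum_filter, ← Finset.sum_filter]
      convert add_le_add (sum_bernoulliWeight_covering_le h0 h1 W hm')
        (sum_bernoulliWeight_sparselyCovered_le h0 h1 hx0 hx1 W hm)
    refine (Finset.sum_le_sum hW).trans ?_
    rw [Finset.sum_const, nsmul_eq_mul]
    have h2 : #(powersetCard k (univ : Finset G)) ≤ Fintype.card G ^ k := by
      rw [Finset.card_powersetCard, Finset.card_univ]
      exact Nat.choose_le_pow _ _
    have hq : 0 ≤ 1 - p + p * x := by nlinarith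
    have h3 : 0 ≤ 1 - (1 - p) ^ k :=
      sub_nonneg.2 (pow_le_one₀ (sub_nonneg.2 h1) (by linarith))
    have h4 : (0 : ℝ) < a - m * k ^ 2 := by rw [sub_pos]; exact_mod_cast hm
    gcongr
    exact_mod_cast h2

end UnionBound

/-! ### Chernoff bounds for the size of the random set -/

section Concentration

variable {G : Type u} [Fintype G] [DecidableEq G]

lemma sum_bernoulliWeight_card_lt_le {p : ℝ} (h0 : 0 ≤ p) (h1 : p ≤ 1) :
    ∑ A : Finset G with (#A : ℝ) < p * Fintype.card G / 2, bernoulliWeight p A ≤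
      Real.exp (-(p * Fintype.card G / 8)) := by
  set N := p * Fintype.card G
  refine (sum_filter_bernoulliWeight_le h0 h1 _
    -- The tilt `1 / 2` gives the exponent `(log 2 - 1) * N / 2`, which is below `-N / 8`.
    (fun A ↦ Real.exp (Real.log 2 * (N / 2)) * (1 / 2) ^ #(A ∩ univ))
    (fun A ↦ by positivity) ?_).trans ?_
  · intro A hA
    rw [Finset.inter_univ, one_div, ← Real.exp_log (show (0 : ℝ) < 2⁻¹ by norm_num),
      ← Real.exp_nat_mul, ← Real.exp_add, Real.log_inv, Real.one_le_exp_iff]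
    have := Real.log_pos (show (1 : ℝ) < 2 by norm_num)
    nlinarith
  · simp_rw [mul_left_comm _ (Real.exp _)]
    rw [← Finset.mul_sum, sum_bernoulliWeight_mul_pow]
    have h2 : 1 - p + p * (1 / 2) ≤ Real.exp (-(p / 2)) := by
      linarith [Real.add_one_le_exp (-(p / 2))]
    calc _ ≤ Real.exp (Real.log 2 * (N / 2)) * Real.exp (-(p / 2)) ^ #(univ : Finset G) := by
          gcongr
      _ ≤ _ := by
        rw [← Real.exp_nat_mul, ← Real.exp_add, Finset.card_univ, Real.exp_le_exp]
        have hN : Fintype.card G * -(p / 2) = -(N / 2) := by simp only [N]; ring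
        have hN0 : 0 ≤ N := by positivity
        rw [hN]
        nlinarith [Real.log_two_lt_d9]

lemma sum_bernoulliWeight_lt_card_le {p : ℝ} (h0 : 0 ≤ p) (h1 : p ≤ 1) :
    ∑ A : Finset G with 2 * (p * Fintype.card G) < (#A : ℝ), bernoulliWeight p A ≤
      Real.exp (-(p * Fintype.card G / 8)) := by
  set N := p * Fintype.card G
  refine (sum_filter_bernoulliWeight_le h0 h1 _
    (fun A ↦ Real.exp (-(Real.log 2 * (2 * N))) * 2 ^ #(A ∩ univ))
    (fun A ↦ by positivity) ?_).trans ?_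
  · intro A hA
    rw [Finset.inter_univ, ← Real.exp_log (show (0 : ℝ) < 2 by norm_num),
      ← Real.exp_nat_mul, ← Real.exp_add, Real.exp_log (show (0 : ℝ) < 2 by norm_num),
      Real.one_le_exp_iff]
    have := Real.log_pos (show (1 : ℝ) < 2 by norm_num)
    nlinarith
  · simp_rw [mul_left_comm _ (Real.exp _)]
    rw [← Finset.mul_sum, sum_bernoulliWeight_mul_pow]
    have h2 : 1 - p + p * 2 ≤ Real.exp p := by linarith [Real.add_one_le_exp p]
    calc _ ≤ Real.exp (-(Real.log 2 * (2 * N))) * Real.exp p ^ #(univ : Finset G) := by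
          gcongr
      _ ≤ _ := by
        rw [← Real.exp_nat_mul, ← Real.exp_add, Finset.card_univ, Real.exp_le_exp]
        have hN : Fintype.card G * p = N := by simp only [N]; ring
        have hN0 : 0 ≤ N := by positivity
        rw [hN]
        nlinarith [Real.log_two_gt_d9]

end Concentration

/-! ### Choice of parameters and asymptotics -/

section Numerics

lemma exp_neg_add_sq_le_one_sub {p : ℝ} (h0 : 0 ≤ p) (h1 : p ≤ 1 / 3) :
    Real.exp (-(p + p ^ 2)) ≤ 1 - p := by
  have h := Real.quadratic_le_exp_of_nonneg (show 0 ≤ p + p ^ 2 by positivity)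
  rw [Real.exp_neg]
  refine inv_le_of_inv_le₀ (by linarith) (le_trans ?_ h)
  rw [inv_le_iff_one_le_mul₀' (by linarith)]
  have h3 : 0 ≤ (1 - p ^ 2) * (1 + p) / 2 - p := by nlinarith
  nlinarith [mul_nonneg (sq_nonneg p) h3]

/-- The choice `x = (p * k)⁻¹` minimises `x⁻¹ * exp (p * k * x)`, the approximate form of the tilted
bound. It gives at most `p * k * exp (1 - p * k)`, of order `L * exp (-L / 4)`, which `h3` makes
small against `p`. -/
lemma multiplicity_base_le {X L p d : ℝ} {k : ℕ} (hX : 0 < X) (hp : 0 < p) (hp1 : p ≤ 1)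
    (hk : 0 < (k : ℝ)) (hk1 : L ≤ 4 * (p * k)) (hk2 : p * k ≤ L / 2)
    (h3 : 2 * Real.exp 2 * L ≤ p * Real.exp (L / 4)) (hd : p * X / 4 ≤ d) :
    0 ≤ X * ((p * k)⁻¹⁻¹ * (1 - p + p * (p * k)⁻¹) ^ k) / d ∧
      X * ((p * k)⁻¹⁻¹ * (1 - p + p * (p * k)⁻¹) ^ k) / d ≤ Real.exp (-1) := by
  have hq0 : 0 ≤ 1 - p + p * (p * k)⁻¹ := by
    have : 0 ≤ p * (p * (k : ℝ))⁻¹ := by positivity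
    linarith
  have hL : 0 < L := by nlinarith [mul_pos hp hk]
  have hd0 : 0 < d := lt_of_lt_of_le (by positivity) hd
  have hq : (1 - p + p * (p * k)⁻¹) ^ k ≤ Real.exp (1 - L / 4) := by
    calc (1 - p + p * (p * k)⁻¹) ^ k ≤ Real.exp (-p + p * (p * k)⁻¹) ^ k := by
          gcongr
          linarith [Real.add_one_le_exp (-p + p * (p * k)⁻¹)]
      _ ≤ _ := by
        rw [← Real.exp_nat_mul, Real.exp_le_exp]
        have : k * (-p + p * (p * k)⁻¹) = 1 - p * k := by field_simp; ring
        rw [this]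
        linarith
  refine ⟨by positivity, ?_⟩
  rw [inv_inv]
  calc _ ≤ X * (L / 2 * Real.exp (1 - L / 4)) / (p * X / 4) := by gcongr
    _ = 2 * L * Real.exp (1 - L / 4) / p := by field_simp; norm_num
    _ ≤ Real.exp (-1) := by
      rw [div_le_iff₀ hp]
      have e1 : Real.exp (1 - L / 4) = Real.exp 2 * Real.exp (-(L / 4) - 1) := by
        rw [← Real.exp_add]; ring_nf
      have e2 : Real.exp (-1) = Real.exp (L / 4) * Real.exp (-(L / 4) - 1) := by
        rw [← Real.exp_add]; ring_nf
      rw [e1, e2]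
      nlinarith [Real.exp_pos (-(L / 4) - 1)]

set_option maxHeartbeats 400000 in
/-- The parameters for the union bound over all `k`-subsets. -/
lemma exists_unionBound_parameters {n : ℕ} {L p : ℝ} (hn : (n : ℝ) = Real.exp L) (hp : 0 < p)
    (hL : 4 ≤ L) (h2 : 2 * L ^ 4 ≤ p ^ 4 * Real.exp L)
    (h3 : 2 * Real.exp 2 * L ≤ p * Real.exp (L / 4)) (h4 : p * (1 + L / 2) ≤ 1)
    (h5 : Real.exp 1 * L ^ 4 ≤ p ^ 3 * Real.exp (3 * L / 4)) :
    ∃ (k m m' : ℕ) (x : ℝ), 0 < x ∧ x ≤ 1 ∧ k ≤ n ∧ m * k ^ 2 < ⌈p * n / 2⌉₊ ∧ m' * k ^ 2 < n ∧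
      (1 - (1 - p) ^ k) ^ m' ≤ Real.exp (-(k * L + L)) ∧
      (n * (x⁻¹ * (1 - p + p * x) ^ k) / (⌈p * n / 2⌉₊ - m * k ^ 2)) ^ m ≤
        Real.exp (-(k * L + L)) := by
  have hp3 : p ≤ 1 / 3 := by nlinarith
  -- With `p * k ≈ L / 4`, a `k`-set misses `A` with probability near `n ^ (-1/4)`.
  obtain ⟨k, hk⟩ : ∃ k : ℕ, k = ⌈L / (4 * p)⌉₊ := ⟨_, rfl⟩
  obtain ⟨X, hX⟩ : ∃ X : ℝ, X = n := ⟨_, rfl⟩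
  obtain ⟨K, hK⟩ : ∃ K : ℝ, K = k := ⟨_, rfl⟩
  rw [← hX] at hn
  rw [← hn] at h2
  have hX0 : 0 < X := hn ▸ Real.exp_pos L
  have hk1 : L ≤ 4 * (p * K) := by
    have := Nat.le_ceil (L / (4 * p))
    rw [← hk, ← hK, div_le_iff₀ (by positivity)] at this
    linarith
  have hk2 : p * K ≤ L / 4 + p := by
    have := Nat.ceil_lt_add_one (show 0 ≤ L / (4 * p) by positivity)
    rw [← hk, ← hK, ← sub_lt_iff_lt_add, lt_div_iff₀ (by positivity)] at this
    linarith
  have hpK1 : 1 ≤ p * K := by linarith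
  have hpK2 : p * K ≤ L / 2 := by linarith
  have hK0 : 0 < K := pos_of_mul_pos_right (by linarith) hp.le
  have hK1 : 1 ≤ K := by
    have : 0 < k := by rw [hK] at hK0; exact_mod_cast hK0
    rw [hK]; exact_mod_cast this
  have hKsq : 4 * K ^ 2 ≤ L ^ 2 / p ^ 2 := by
    rw [le_div_iff₀ (by positivity)]
    nlinarith
  have hbig : 2 * L ^ 2 / p ^ 2 ≤ X / (4 * K ^ 2) := by
    calc 2 * L ^ 2 / p ^ 2 = 2 * L ^ 4 / p ^ 4 / (L ^ 2 / p ^ 2) := by field_simp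
      _ ≤ X / (4 * K ^ 2) := by
        gcongr
        rw [div_le_iff₀ (by positivity)]
        linarith
  have hLp : 4 ≤ L ^ 2 / (4 * p) := by
    rw [le_div_iff₀ (by positivity)]
    nlinarith
  have hLp2 : L ≤ L ^ 2 / (4 * p) := by
    rw [le_div_iff₀ (by positivity)]
    nlinarith
  have hKL : K * L ≤ L ^ 2 / (2 * p) := by
    rw [le_div_iff₀ (by positivity)]
    nlinarith
  -- The budget `L ^ 2 / p` pays for `K * L` (the choices of `W`), for `L` (the final factor `1 /
  -- n`), and leaves slack for rounding.
  have hsum : L ^ 2 / p = L ^ 2 / (2 * p) + L ^ 2 / (4 * p) + L ^ 2 / (4 * p) := by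
    field_simp; norm_num
  have hbig1 : 1 ≤ X / (4 * K ^ 2) := by
    refine le_trans ?_ hbig
    rw [le_div_iff₀ (by positivity)]
    nlinarith
  have hXK : 4 * K ^ 2 ≤ X := by
    rw [le_div_iff₀ (by positivity)] at hbig1
    linarith
  -- These make `m * k ^ 2` at most half of `p * n / 2`, and `m' * k ^ 2` at most half of `n`.
  refine ⟨k, ⌊p * X / (4 * K ^ 2)⌋₊, ⌊X / (2 * K ^ 2)⌋₊, (p * K)⁻¹, by positivity,
    inv_le_one_of_one_le₀ hpK1, ?_, ?_, ?_, ?_, ?_⟩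
  · have : K ≤ X := by nlinarith
    rw [hX, hK] at this
    exact_mod_cast this
  · rw [Nat.lt_ceil]
    push_cast
    rw [← hX, ← hK]
    have := Nat.floor_le (show 0 ≤ p * X / (4 * K ^ 2) by positivity)
    rw [le_div_iff₀ (by positivity)] at this
    nlinarith [mul_pos hp hX0]
  · have := Nat.floor_le (show 0 ≤ X / (2 * K ^ 2) by positivity)
    rw [le_div_iff₀ (by positivity)] at this
    have h : (⌊X / (2 * K ^ 2)⌋₊ : ℝ) * K ^ 2 < X := by linarith
    rw [hK, hX] at h
    rw [hK, hX]
    exact_mod_cast h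
  -- The error `p + p ^ 2 * K` is at most `p * (1 + L / 2)`, which `h4` bounds by `1`.
  · have hpow : Real.exp (-(L / 4 + 1)) ≤ (1 - p) ^ k := by
      calc Real.exp (-(L / 4 + 1)) ≤ Real.exp (-(p + p ^ 2)) ^ k := by
            rw [← Real.exp_nat_mul, ← hK, Real.exp_le_exp]
            nlinarith
        _ ≤ _ := by
          gcongr
          exact exp_neg_add_sq_le_one_sub hp.le hp3
    have hm : X / (4 * K ^ 2) ≤ ⌊X / (2 * K ^ 2)⌋₊ := by
      have h := Nat.lt_floor_add_one (X / (2 * K ^ 2))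
      have h' : X / (2 * K ^ 2) = X / (4 * K ^ 2) + X / (4 * K ^ 2) := by field_simp; norm_num
      linarith
    have hu : 1 - (1 - p) ^ k ≤ Real.exp (-Real.exp (-(L / 4 + 1))) := by
      linarith [Real.add_one_le_exp (-Real.exp (-(L / 4 + 1)))]
    have hu0 : 0 ≤ 1 - (1 - p) ^ k :=
      sub_nonneg.2 (pow_le_one₀ (by linarith) (by linarith))
    refine (pow_le_pow_left₀ hu0 hu _).trans ?_
    rw [← Real.exp_nat_mul, Real.exp_le_exp, mul_neg, neg_le_neg_iff, ← hK]
    calc K * L + L ≤ L ^ 2 / p := by linarith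
      _ ≤ X / (L ^ 2 / p ^ 2) * Real.exp (-(L / 4 + 1)) := by
        have he : X * Real.exp (-(L / 4 + 1)) = Real.exp (3 * L / 4) / Real.exp 1 := by
          rw [hn, ← Real.exp_add, ← Real.exp_sub]
          ring_nf
        rw [div_mul_eq_mul_div, he, div_div, div_le_div_iff₀ hp (by positivity),
          ← sub_nonneg]
        have := mul_le_mul_of_nonneg_right h5 (show 0 ≤ 1 / p ^ 2 by positivity)
        have h6 : p ^ 3 * Real.exp (3 * L / 4) * (1 / p ^ 2) = Real.exp (3 * L / 4) * p := by
          field_simp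
        rw [h6] at this
        refine sub_nonneg.2 (le_trans (le_of_eq ?_) this)
        field_simp
      _ ≤ _ := by
        gcongr
        exact (div_le_div_of_nonneg_left hX0.le (by positivity) hKsq).trans hm
  · set m := ⌊p * X / (4 * K ^ 2)⌋₊ with hmdef
    have hmK : (m : ℝ) * K ^ 2 ≤ p * X / 4 := by
      have := Nat.floor_le (show 0 ≤ p * X / (4 * K ^ 2) by positivity)
      rw [le_div_iff₀ (by positivity)] at this
      linarith
    have hm : K * L + L ≤ m := by
      have h := Nat.lt_floor_add_one (p * X / (4 * K ^ 2))
      have h' : 2 * (L ^ 2 / p) ≤ p * X / (4 * K ^ 2) := by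
        calc 2 * (L ^ 2 / p) = p * (2 * L ^ 2 / p ^ 2) := by field_simp
          _ ≤ p * (X / (4 * K ^ 2)) := by gcongr
          _ = _ := by ring
      rw [← hmdef] at h
      linarith
    have hden : p * X / 4 ≤ ⌈p * n / 2⌉₊ - m * (k : ℝ) ^ 2 := by
      rw [← hK, ← hX]
      linarith [Nat.le_ceil (p * X / 2)]
    obtain ⟨hbase0, hbase⟩ := multiplicity_base_le hX0 hp (by linarith) (k := k)
      (hK ▸ hK0) (hK ▸ hk1) (hK ▸ hpK2) h3 hden
    rw [← hX, hK] at *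
    refine (pow_le_pow_left₀ hbase0 hbase _).trans ?_
    rw [← Real.exp_nat_mul, Real.exp_le_exp]
    linarith

lemma eventually_mul_log_pow_le_rpow (C : ℝ) {r : ℝ} (hr : 0 < r) :
    ∀ᶠ n : ℕ in Filter.atTop, C * Real.log n ^ 4 ≤ (n : ℝ) ^ r := by
  have h := (isLittleO_log_rpow_rpow_atTop 4 hr).bound
    (show (0 : ℝ) < (max C 1)⁻¹ by positivity)
  filter_upwards [tendsto_natCast_atTop_atTop.eventually h, Filter.eventually_ge_atTop 1]
    with n hn h1
  have hn1 : (1 : ℝ) ≤ n := by exact_mod_cast h1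
  have hlog := Real.log_nonneg hn1
  rw [Real.norm_of_nonneg (by positivity), Real.norm_of_nonneg (by positivity),
    inv_mul_eq_div, le_div_iff₀ (by positivity)] at hn
  norm_cast at hn
  refine le_trans ?_ hn
  rw [mul_comm]
  gcongr
  exact le_max_left _ _

end Numerics

/-! ### Random sets are rarely minimal complements; the theorem -/

section Main

open scoped Classical in
/-- The set of those subsets of `G` that are minimal complements or have a size far from `p * |G|`
is unlikely to contain a random set. -/
lemma eventually_sum_bernoulliWeight_le {ε : ℝ} (hε : 0 < ε) (hε' : ε < 1 / 4) :
    ∀ᶠ n : ℕ in Filter.atTop, ∀ (G : Type u) [AddCommGroup G] [Fintype G],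
      Fintype.card G = n → ∀ p : ℝ, p = (n : ℝ) ^ (ε - 1 / 4) → 0 < p ∧ p ≤ 1 ∧
        ∑ A ∈ univ.filter (fun A : Finset G ↦ IsMinimalComplement (A : Set G) ∨
          (#A : ℝ) < p * n / 2 ∨ 2 * (p * n) < (#A : ℝ)), bernoulliWeight p A ≤ 4 / n := by
  have hlog : ∀ᶠ n : ℕ in Filter.atTop, 4 ≤ Real.log n :=
    (Real.tendsto_log_atTop.comp tendsto_natCast_atTop_atTop).eventually_ge_atTop 4
  filter_upwards [hlog, Filter.eventually_ge_atTop 1,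
    eventually_mul_log_pow_le_rpow 2 (show 0 < ε * 4 by linarith),
    eventually_mul_log_pow_le_rpow (2 * Real.exp 2) hε,
    eventually_mul_log_pow_le_rpow 1 (show 0 < 1 / 4 - ε by linarith),
    eventually_mul_log_pow_le_rpow (Real.exp 1) (show 0 < ε * 3 by linarith)]
    with n hL h1 c2 c3 c4 c5
  intro G _ _ hG p hp
  have hn0 : (0 : ℝ) < n := by exact_mod_cast h1
  set L := Real.log n with hLdef
  have hn : (n : ℝ) = Real.exp L := (Real.exp_log hn0).symm
  have hrp (r : ℝ) : (n : ℝ) ^ r = Real.exp (L * r) := Real.rpow_def_of_pos hn0 r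
  rw [hrp] at hp c2 c3 c4 c5
  have hp0 : 0 < p := hp ▸ Real.exp_pos _
  have hpL : p * Real.exp (L * (1 / 4 - ε)) = 1 := by
    rw [hp, ← Real.exp_add, ← Real.exp_zero]; ring_nf
  have hL3 : 4 ^ 3 ≤ L ^ 3 := pow_le_pow_left₀ (by norm_num) hL 3
  have hL5 : 64 * L ≤ L ^ 4 := by nlinarith
  have hL4 : L ≤ L ^ 4 := by linarith
  have h4 : p * (1 + L / 2) ≤ 1 := by
    rw [← hpL]
    gcongr
    linarith
  have hp1 : p ≤ 1 := by nlinarith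
  -- For `p = n ^ (ε - 1/4)` the right-hand sides of `h2`, `h3` and `h5` are `n ^ (4 * ε)`, `n ^ ε`
  -- and `n ^ (3 * ε)`: here the exponent `1/4` is used.
  have h2 : 2 * L ^ 4 ≤ p ^ 4 * Real.exp L := by
    refine c2.trans_eq ?_
    rw [hp, ← Real.exp_nat_mul, ← Real.exp_add]
    push_cast
    ring_nf
  have h3 : 2 * Real.exp 2 * L ≤ p * Real.exp (L / 4) := by
    refine le_trans (by gcongr) (c3.trans_eq ?_)
    rw [hp, ← Real.exp_add]
    ring_nf
  have h5 : Real.exp 1 * L ^ 4 ≤ p ^ 3 * Real.exp (3 * L / 4) := by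
    refine c5.trans_eq ?_
    rw [hp, ← Real.exp_nat_mul, ← Real.exp_add]
    push_cast
    ring_nf
  refine ⟨hp0, hp1, ?_⟩
  obtain ⟨k, m, m', x, hx0, hx1, hk, hm, hm', hb1, hb2⟩ :=
    exists_unionBound_parameters hn hp0 hL h2 h3 h4 h5
  rw [← hG] at hk hm'
  have hmain := sum_bernoulliWeight_isMinimalComplement_le hp0.le hp1 hx0 hx1 hk hm hm'
  rw [hG] at hmain
  have hlow := sum_bernoulliWeight_card_lt_le (G := G) hp0.le hp1
  have hupp := sum_bernoulliWeight_lt_card_le (G := G) hp0.le hp1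
  rw [hG] at hlow hupp
  have htail : Real.exp (-(p * n / 8)) ≤ 1 / n := by
    rw [one_div, hn, ← Real.exp_neg, Real.exp_le_exp, neg_le_neg_iff, ← hn]
    have hp4 : p ^ 4 ≤ p := pow_le_of_le_one hp0.le hp1 (by norm_num)
    have : p ^ 4 * n ≤ p * n := by gcongr
    rw [← hn] at h2
    nlinarith
  -- The factor `n ^ k` cancels `exp (-k * L)`, and the remaining `exp (-L)` is `1 / n`.
  have hmid : ∑ A ∈ univ.filter (fun A : Finset G ↦ IsMinimalComplement (A : Set G) ∧
      ⌈p * n / 2⌉₊ ≤ #A), bernoulliWeight p A ≤ 2 / n := by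
    refine hmain.trans ((mul_le_mul_of_nonneg_left (add_le_add hb1 hb2)
      (by positivity)).trans_eq ?_)
    rw [← two_mul, hn, ← Real.exp_nat_mul, mul_left_comm, ← Real.exp_add, div_eq_mul_inv,
      ← Real.exp_neg]
    ring_nf
  have hsub : univ.filter (fun A : Finset G ↦ IsMinimalComplement (A : Set G) ∨
      (#A : ℝ) < p * n / 2 ∨ 2 * (p * n) < (#A : ℝ)) ⊆
      univ.filter (fun A : Finset G ↦ IsMinimalComplement (A : Set G) ∧ ⌈p * n / 2⌉₊ ≤ #A) ∪
      (univ.filter (fun A : Finset G ↦ (#A : ℝ) < p * n / 2) ∪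
      univ.filter (fun A : Finset G ↦ 2 * (p * n) < (#A : ℝ))) := by
    intro A
    simp only [Finset.mem_filter, Finset.mem_univ, true_and, Finset.mem_union, Nat.ceil_le]
    rcases lt_or_ge (#A : ℝ) (p * n / 2) with h | h <;> tauto
  have hnn := bernoulliWeight_nonneg (G := G) hp0.le hp1
  have hun (s t : Finset (Finset G)) : ∑ A ∈ s ∪ t, bernoulliWeight p A ≤
      ∑ A ∈ s, bernoulliWeight p A + ∑ A ∈ t, bernoulliWeight p A := by
    rw [← Finset.sum_union_inter]
    exact le_add_of_nonneg_right (Finset.sum_nonneg fun A _ ↦ hnn A)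
  refine (Finset.sum_le_sum_of_subset_of_nonneg hsub fun A _ _ ↦ hnn A).trans ?_
  refine (hun _ _).trans ((add_le_add_right (hun _ _) _).trans ?_)
  refine (add_le_add hmid (add_le_add (hlow.trans htail) (hupp.trans htail))).trans_eq ?_
  ring

lemma minimalComplementThreshold_le_of_not_isMinimalComplement {G : Type u} [AddCommGroup G]
    [Finite G] {A : Finset G} (hA : A.Nonempty) (h : ¬ IsMinimalComplement (A : Set G)) :
    minimalComplementThreshold G ≤ #A := by
  refine csSup_le ⟨0, Nat.zero_le _, fun C hC hC0 ↦ ?_⟩ ?_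
  · rw [Nat.le_zero, Set.ncard_eq_zero C.toFinite] at hC0
    exact absurd hC0 hC.ne_empty
  · rintro T ⟨-, hT⟩
    by_contra! hlt
    exact h (hT A (by simpa using hA) (by rw [Set.ncard_coe_finset]; exact hlt.le))

lemma minimalComplementThreshold_le_card (G : Type u) [AddCommGroup G] :
    minimalComplementThreshold G ≤ Nat.card G := by
  refine csSup_le' ?_
  rintro T ⟨hT, -⟩
  exact hT

lemma exists_minimalComplementThreshold_le {ε : ℝ} (hε : 0 < ε) :
    ∃ K : ℝ, ∀ (G : Type u) [AddCommGroup G] [Finite G],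
      (minimalComplementThreshold G : ℝ) ≤ K * (Nat.card G : ℝ) ^ (3 / 4 + ε) := by
  rcases le_or_gt (1 / 4) ε with hε' | hε'
  · refine ⟨1, fun G _ _ ↦ ?_⟩
    have h1 : (1 : ℝ) ≤ Nat.card G := by exact_mod_cast Nat.card_pos
    calc (minimalComplementThreshold G : ℝ) ≤ (Nat.card G : ℝ) ^ (1 : ℝ) := by
          rw [Real.rpow_one]
          exact_mod_cast minimalComplementThreshold_le_card G
      _ ≤ _ := by
        rw [one_mul]
        exact Real.rpow_le_rpow_of_exponent_le h1 (by linarith)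
  obtain ⟨N, hN⟩ := Filter.eventually_atTop.1 (eventually_sum_bernoulliWeight_le.{u} hε hε')
  -- From order `5` on the failure bound `4 / n` is below `1`, so a good `A` exists; smaller groups
  -- are absorbed by the constant.
  refine ⟨max 2 (max N 5 : ℕ), fun G _ _ ↦ ?_⟩
  have h1 : (1 : ℝ) ≤ Nat.card G := by exact_mod_cast Nat.card_pos
  rcases lt_or_ge (Nat.card G) (max N 5) with h | h
  · calc (minimalComplementThreshold G : ℝ) ≤ (max N 5 : ℕ) * 1 := by
          rw [mul_one]
          exact_mod_cast (minimalComplementThreshold_le_card G).trans h.le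
      _ ≤ _ := by
        gcongr
        · exact le_max_right _ _
        · exact Real.one_le_rpow h1 (by linarith)
  · classical
    have := Fintype.ofFinite G
    obtain ⟨hp0, hp1, hsum⟩ := hN (Nat.card G) ((le_max_left _ _).trans h) G
      Nat.card_eq_fintype_card.symm _ rfl
    set p := (Nat.card G : ℝ) ^ (ε - 1 / 4)
    obtain ⟨A, hA⟩ : ∃ A : Finset G, ¬ (IsMinimalComplement (A : Set G) ∨
        (#A : ℝ) < p * Nat.card G / 2 ∨ 2 * (p * Nat.card G) < (#A : ℝ)) := by
      by_contra! hall
      rw [Finset.filter_true_of_mem fun A _ ↦ hall A, sum_bernoulliWeight,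
        le_div_iff₀ (by linarith)] at hsum
      have : (5 : ℝ) ≤ Nat.card G := by exact_mod_cast (le_max_right _ _).trans h
      linarith
    push Not at hA
    obtain ⟨hA1, hA2, hA3⟩ := hA
    have hne : A.Nonempty := by
      rw [← Finset.card_pos]
      have : (0 : ℝ) < #A := lt_of_lt_of_le (by positivity) hA2
      exact_mod_cast this
    calc (minimalComplementThreshold G : ℝ) ≤ #A := by
          exact_mod_cast minimalComplementThreshold_le_of_not_isMinimalComplement hne hA1
      _ ≤ 2 * (p * Nat.card G) := hA3
      _ = 2 * (Nat.card G : ℝ) ^ (3 / 4 + ε) := by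
        rw [← Real.rpow_add_one (by linarith)]
        ring_nf
      _ ≤ _ := by
        gcongr
        exact le_max_left _ _

theorem theorem1p3 (ε : ℝ) (hε : 0 < ε) :
    (∃ K : ℝ, ∀ (G : Type u) [AddCommGroup G] [Finite G],
      (minimalComplementThreshold G : ℝ) ≤ K * (Nat.card G : ℝ) ^ (3 / 4 + ε)) ∧
    (∃ K : ℝ, ∀ n : ℕ, 1 ≤ n →
      (minimalComplementThresholdOfOrder n : ℝ) ≤ K * (n : ℝ) ^ (3 / 4 + ε)) ∧
    (ε < 1 / 4 → ∀ δ : ℝ, 0 < δ → ∃ N : ℕ, ∀ (G : Type u) [AddCommGroup G] [Finite G],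
      N ≤ Nat.card G → ∀ p : unitInterval, (p : ℝ) = (Nat.card G : ℝ) ^ (ε - 1 / 4) →
        1 - δ ≤ (ProbabilityTheory.setBernoulli (Set.univ : Set G) p).real
          {A : Set G | ¬ IsMinimalComplement A}) := by
  refine ⟨exists_minimalComplementThreshold_le hε, ?_, ?_⟩
  · obtain ⟨K, hK⟩ := exists_minimalComplementThreshold_le.{0} hε
    refine ⟨K, fun n hn ↦ ?_⟩
    have : NeZero n := ⟨by omega⟩
    have hmem : minimalComplementThreshold (ZMod n) ∈ {t : ℕ | ∃ (G : Type) (_ : AddCommGroup G),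
        Finite G ∧ Nat.card G = n ∧ minimalComplementThreshold G = t} :=
      ⟨ZMod n, inferInstance, inferInstance, Nat.card_zmod n, rfl⟩
    have h1 : (minimalComplementThresholdOfOrder n : ℝ) ≤ minimalComplementThreshold (ZMod n) := by
      exact_mod_cast Nat.sInf_le hmem
    have h2 := hK (ZMod n)
    rw [Nat.card_zmod] at h2
    exact h1.trans h2
  · intro hε' δ hδ
    classical
    obtain ⟨N, hN⟩ := Filter.eventually_atTop.1 (eventually_sum_bernoulliWeight_le.{u} hε hε')
    refine ⟨max N ⌈4 / δ⌉₊, fun G _ _ hG p hp ↦ ?_⟩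
    have := Fintype.ofFinite G
    obtain ⟨hp0, hp1, hsum⟩ := hN (Nat.card G) ((le_max_left _ _).trans hG) G
      Nat.card_eq_fintype_card.symm p hp
    have hcard : 4 / (Nat.card G : ℝ) ≤ δ := by
      have h1 : 4 / δ ≤ Nat.card G := Nat.ceil_le.1 ((le_max_right _ _).trans hG)
      have h2 : (0 : ℝ) < Nat.card G := by exact_mod_cast Nat.card_pos
      rw [div_le_iff₀ hδ] at h1
      rw [div_le_iff₀ h2]
      linarith
    rw [setBernoulli_real_eq_sum]
    have htot := sum_bernoulliWeight (G := G) p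
    rw [← Finset.sum_filter_add_sum_filter_not univ
      (fun A : Finset G ↦ (A : Set G) ∈ {A : Set G | ¬ IsMinimalComplement A})] at htot
    have hle : ∑ A ∈ univ.filter (fun A : Finset G ↦
        ¬ (A : Set G) ∈ {A : Set G | ¬ IsMinimalComplement A}), bernoulliWeight (p : ℝ) A ≤
        4 / Nat.card G := by
      refine le_trans (Finset.sum_le_sum_of_subset_of_nonneg ?_
        fun A _ _ ↦ bernoulliWeight_nonneg hp0.le hp1 A) hsum
      intro A hA
      simp only [Finset.mem_filter, Finset.mem_univ, true_and, Set.mem_ofPred_eq, not_not] at hA ⊢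
      exact Or.inl hA
    linarith

end Main
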